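/- Let $\rho_{AB}$ be a density matrix (positive semidefinite, trace one) on $\mathbb{C}^{d_A}\otimes\mathbb{C}^{d_B}$, with marginals $\rho_A=\mathrm{Tr}_B\,\rho_{AB}$ and $\rho_B=\mathrm{Tr}_A\,\rho_{AB}$, and put $N=d_Ad_B$. Let $\lambda(\rho_{AB}),\lambda(\rho_A),\lambda(\rho_B)\in\mathbb{R}^N$ be the vectors of eigenvalues, counted with multiplicity, those of $\rho_A$ and $\rho_B$ being extended by zeros to length $N$. For $p,q\in\mathbb{R}^N$ write $p\succ q$ ($p$ majorizes $q$) if for every $k\le N$ the sum of the $k$ largest components of $p$ is at least that of $q$, and the sums of all components agree. A measure of mixedness is a function $F$ of probability vectors $p\in\mathbb{R}^N$ that is continuous and Schur-concave ($p\succ q$ implies $F(p)\le F(q)$) and has minimum value $0$, attained at the pure distributions (those with one component equal to $1$); for a state $\sigma\in\{\rho_{AB},\rho_A,\rho_B\}$ put $F(\sigma)=F(\lambda(\sigma))$. The state $\rho_{AB}$ is called NPT (negative partial transpose) if its partial transpose with respect to $B$ has a negative eigenvalue. **Theorem 1.** (i) If there is a measure of mixedness $F$ for which the mixedness criterion $$F(\rho_{AB})\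 \ge\ \max\{F(\rho_A),F(\rho_B)\}$$ fails, then $\rho_{AB}$ is NPT. (ii) More generally, if $\rho_{AB}$ violates the majorization criterion, i.e. if $\lambda(\rho_A)\succ\lambda(\rho_{AB})$ and $\lambda(\rho_B)\succ\lambda(\rho_{AB})$ do not both hold, then $\rho_{AB}$ is NPT. -/

import Mathlib

open scoped ComplexOrder

/-- A density matrix on the finite-dimensional Hilbert space `ℂⁿ` (basis indexed by `n`):
a positive semidefinite complex matrix of trace one. -/
structure DensityMatrix (n : Type*) [Fintype n] where
  mat : Matrix n n ℂ
  posSemidef : mat.PosSemidef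
  trace_eq_one : mat.trace = 1

namespace DensityMatrix

/-- The eigenvalues of `ρ`, counted with multiplicity, in decreasing order, as a vector of
length `N`: it is filled up with zeros, so that spectra of states of different dimensions can be
compared. It is only used with `N` at least the dimension of `ρ`. -/
noncomputable def spectrumVec {n : Type*} [Fintype n] [DecidableEq n] (ρ : DensityMatrix n)
    (N : ℕ) : Fin N → ℝ :=
  fun i => if h : (i : ℕ) < Fintype.card n then ρ.posSemidef.isHermitian.eigenvalues₀ ⟨i, h⟩ else 0

/-- The marginal state of the first party: the partial trace over the second party. -/
def marginalA {A B : Type*} [Fintype A] [Fintype B] (ρ : DensityMatrix (A × B)) :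
    DensityMatrix A where
  mat := Matrix.of fun a a' => ∑ b, ρ.mat (a, b) (a', b)
  posSemidef := by
    have h : (Matrix.of fun a a' => ∑ b, ρ.mat (a, b) (a', b)) =
        ∑ b, ρ.mat.submatrix (fun a : A => (a, b)) (fun a : A => (a, b)) := by
      ext a a'
      simp [Matrix.sum_apply]
    rw [h]
    exact Matrix.posSemidef_sum _ fun b _ => ρ.posSemidef.submatrix _
  trace_eq_one := by
    rw [← ρ.trace_eq_one]
    simp [Matrix.trace, Fintype.sum_prod_type]

/-- The marginal state of the second party: the partial trace over the first party. -/
def marginalB {A B : Type*} [Fintype A] [Fintype B] (ρ : DensityMatrix (A × B)) :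
    DensityMatrix B where
  mat := Matrix.of fun b b' => ∑ a, ρ.mat (a, b) (a, b')
  posSemidef := by
    have h : (Matrix.of fun b b' => ∑ a, ρ.mat (a, b) (a, b')) =
        ∑ a, ρ.mat.submatrix (fun b : B => (a, b)) (fun b : B => (a, b)) := by
      ext b b'
      simp [Matrix.sum_apply]
    rw [h]
    exact Matrix.posSemidef_sum _ fun a _ => ρ.posSemidef.submatrix _
  trace_eq_one := by
    rw [← ρ.trace_eq_one]
    simp [Matrix.trace, Fintype.sum_prod_type_right]

/-- The partial transpose of a bipartite state with respect to the second party. -/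
def partialTranspose {A B : Type*} [Fintype A] [Fintype B] (ρ : DensityMatrix (A × B)) :
    Matrix (A × B) (A × B) ℂ :=
  Matrix.of fun x y => ρ.mat (x.1, y.2) (y.1, x.2)

theorem partialTranspose_isHermitian {A B : Type*} [Fintype A] [Fintype B]
    (ρ : DensityMatrix (A × B)) : ρ.partialTranspose.IsHermitian := by
  ext x y
  exact ρ.posSemidef.isHermitian.apply (x.1, y.2) (y.1, x.2)

/-- A bipartite state is NPT if its partial transpose has a negative eigenvalue. -/
def IsNPT {A B : Type*} [Fintype A] [Fintype B] [DecidableEq A] [DecidableEq B]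
    (ρ : DensityMatrix (A × B)) : Prop :=
  ∃ i, ρ.partialTranspose_isHermitian.eigenvalues i < 0

end DensityMatrix

/-- The sum of the `k` largest components of `v`, i.e. the largest sum of `k` components at distinct
positions (for `k ≤ N`). -/
noncomputable def sumLargest {N : ℕ} (k : ℕ) (v : Fin N → ℝ) : ℝ :=
  ⨆ s : {s : Finset (Fin N) // s.card = k}, ∑ i ∈ s.1, v i

/-- `Majorizes p q` is `p ≻ q`: for every `k` the `k` largest components of `p` sum to at least the
sum of the `k` largest components of `q`, and both vectors have the same total (which is automatic
for probability vectors). -/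
def Majorizes {N : ℕ} (p q : Fin N → ℝ) : Prop :=
  (∀ k ≤ N, sumLargest k q ≤ sumLargest k p) ∧ ∑ i, p i = ∑ i, q i

/-- A measure of mixedness on probability vectors of length `N`: continuous and Schur-concave on the
probability simplex, with minimum value zero, attained at the pure distributions. -/
structure IsMixednessMeasure {N : ℕ} (F : (Fin N → ℝ) → ℝ) : Prop where
  continuousOn : ContinuousOn F (stdSimplex ℝ (Fin N))
  schurConcave : ∀ p ∈ stdSimplex ℝ (Fin N), ∀ q ∈ stdSimplex ℝ (Fin N),
    Majorizes p q → F p ≤ F q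
  nonneg : ∀ p ∈ stdSimplex ℝ (Fin N), 0 ≤ F p
  pure_eq_zero : ∀ i, F (Pi.single i 1) = 0

namespace DensityMatrix

/-- The mixedness criterion `F(ρ_AB) ≥ max {F(ρ_A), F(ρ_B)}`. The three spectra are compared as
probability vectors of length `dim A * dim B`, those of the marginals being filled up with
zeros. -/
def MixednessCriterion {A B : Type*} [Fintype A] [Fintype B] [DecidableEq A] [DecidableEq B]
    (F : (Fin (Fintype.card (A × B)) → ℝ) → ℝ) (ρ : DensityMatrix (A × B)) : Prop :=
  F (ρ.spectrumVec _) ≥ max (F (ρ.marginalA.spectrumVec _)) (F (ρ.marginalB.spectrumVec _))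

/-- The majorization criterion: `ρ_A ≻ ρ_AB` and `ρ_B ≻ ρ_AB`. -/
def MajorizationCriterion {A B : Type*} [Fintype A] [Fintype B] [DecidableEq A] [DecidableEq B]
    (ρ : DensityMatrix (A × B)) : Prop :=
  Majorizes (ρ.marginalA.spectrumVec (Fintype.card (A × B))) (ρ.spectrumVec _) ∧
    Majorizes (ρ.marginalB.spectrumVec (Fintype.card (A × B))) (ρ.spectrumVec _)

end DensityMatrix

/-! By contraposition, suppose the partial transpose is positive semidefinite. Testing it on
antisymmetrised vectors gives the reduction inequality `ρ ≤ 1 ⊗ σ`, with `σ` the marginal on `B`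
(`dotProduct_mulVec_le_of_partialTranspose_posSemidef`). Let `p i`, `x i` be the eigenpairs of `ρ`,
`s j`, `f j` those of `σ`, and `t i j = ⟨x i, (1 ⊗ |f j⟩⟨f j|) x i⟩`. Computing `σ` from `ρ` gives
`∑ i, p i * t i j = s j`, so `D i j = p i * t i j / s j` satisfies `p = D s` and has column sums at
most one. Its row sums are `p i * ⟨x i, (1 ⊗ σ⁻¹) x i⟩`, at most one by the reduction inequality
(`exists_weights_of_reduction`). Thus `D` is doubly substochastic, and `sum_mul_le_sumLargest` turns
this into majorization, both traces being one. Exchanging the parties handles the other marginal;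
Schur-concavity then gives (i) from (ii). -/

open Matrix Finset

/-! ### Positive partial transpose and the reduction inequality -/

section QuadraticForm

variable {n : Type*} [Fintype n] [DecidableEq n]

/-- The quadratic form of a Hermitian matrix in terms of its spectral decomposition. -/
theorem Matrix.IsHermitian.dotProduct_mulVec_eq_sum {M : Matrix n n ℂ} (hM : M.IsHermitian)
    (v : EuclideanSpace ℂ n) :
    star v.ofLp ⬝ᵥ (M *ᵥ v.ofLp) =
      ((∑ i, hM.eigenvalues i * ‖inner ℂ (hM.eigenvectorBasis i) v‖ ^ 2 : ℝ) : ℂ) := by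
  set b := hM.eigenvectorBasis with hb
  have h1 : M *ᵥ v.ofLp =
      (∑ i, (inner ℂ (b i) v * (hM.eigenvalues i : ℂ)) • b i : EuclideanSpace ℂ n).ofLp := by
    conv_lhs => rw [← b.sum_repr' v]
    rw [WithLp.ofLp_sum, WithLp.ofLp_sum, Matrix.mulVec_sum]
    refine Finset.sum_congr rfl fun i _ => ?_
    rw [WithLp.ofLp_smul, WithLp.ofLp_smul, Matrix.mulVec_smul, hM.mulVec_eigenvectorBasis,
      mul_smul]
    rfl
  have h2 : ∀ w : EuclideanSpace ℂ n, star v.ofLp ⬝ᵥ w.ofLp = inner ℂ v w := fun w => by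
    rw [EuclideanSpace.inner_eq_star_dotProduct, dotProduct_comm]
  rw [h1, h2, inner_sum]
  push_cast
  refine Finset.sum_congr rfl fun i _ => ?_
  rw [inner_smul_right, ← inner_conj_symm v (b i), mul_right_comm, Complex.mul_conj',
    mul_comm]

/-- The reduction inequality `M ≤ 1 ⊗ Tr_A M`, as an inequality of quadratic forms, for a bipartite
matrix with positive semidefinite partial transpose. -/
theorem dotProduct_mulVec_le_of_partialTranspose_posSemidef {A B : Type*} [Fintype A] [Fintype B]
    [DecidableEq A] {M : Matrix (A × B) (A × B) ℂ}
    (hT : (Matrix.of fun x y : A × B => M (y.1, x.2) (x.1, y.2)).PosSemidef) (v : A × B → ℂ) :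
    star v ⬝ᵥ (M *ᵥ v) ≤ ∑ a, star (fun b => v (a, b)) ⬝ᵥ
      ((Matrix.of fun b b' => ∑ c, M (c, b) (c, b')) *ᵥ fun b => v (a, b)) := by
  set T : Matrix (A × B) (A × B) ℂ := Matrix.of fun x y => M (y.1, x.2) (x.1, y.2) with hTdef
  let ι : A → (B → ℂ) → A × B → ℂ := fun c w y => if y.1 = c then w y.2 else 0
  have hι : ∀ c d w w', star (ι c w) ⬝ᵥ (T *ᵥ ι d w') =
      ∑ b, ∑ b', star (w b) * (M (d, b) (c, b') * w' b') := by
    intro c d w w'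
    simp only [dotProduct, mulVec, Fintype.sum_prod_type, ι, Pi.star_apply, hTdef, Matrix.of_apply,
      mul_ite, mul_zero, apply_ite star, star_zero, ite_mul, zero_mul, Finset.mul_sum]
    rw [Finset.sum_eq_single c (fun x _ hx => by simp [hx]) (by simp)]
    refine Finset.sum_congr rfl fun b _ => ?_
    simp only [if_true]
    rw [Finset.sum_eq_single d (fun x _ hx => by simp [hx]) (by simp)]
    simp
  let P : A → A → ℂ := fun a c => ∑ b, ∑ b', star (v (a, b)) * (M (c, b) (c, b') * v (a, b'))
  let Q : A → A → ℂ := fun a c => ∑ b, ∑ b', star (v (a, b)) * (M (a, b) (c, b') * v (c, b'))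
  -- With `v_a` the slice of `v` at `a`, the test vector is `e_c ⊗ v_a - e_a ⊗ v_c`. Summed over `a`
  -- and `c`, the `P` terms give `1 ⊗ Tr_A M` and the cross terms `Q` give `M`.
  have hexp : ∀ a c, star (ι c (fun b => v (a, b)) - ι a (fun b => v (c, b))) ⬝ᵥ
      (T *ᵥ (ι c (fun b => v (a, b)) - ι a (fun b => v (c, b)))) =
      P a c + P c a - Q a c - Q c a := by
    intro a c
    rw [Matrix.mulVec_sub, star_sub, sub_dotProduct, dotProduct_sub, dotProduct_sub]
    simp only [hι, P, Q]
    ring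
  have hpos : 0 ≤ ∑ a, ∑ c, (P a c + P c a - Q a c - Q c a) :=
    Finset.sum_nonneg fun a _ => Finset.sum_nonneg fun c _ => by
      rw [← hexp]; exact hT.dotProduct_mulVec_nonneg _
  have hsum : ∑ a, ∑ c, (P a c + P c a - Q a c - Q c a) =
      2 * (∑ a, ∑ c, P a c - ∑ a, ∑ c, Q a c) := by
    simp only [Finset.sum_sub_distrib, Finset.sum_add_distrib]
    rw [Finset.sum_comm (f := fun a c => P c a), Finset.sum_comm (f := fun a c => Q c a)]
    ring
  have hQ : star v ⬝ᵥ (M *ᵥ v) = ∑ a, ∑ c, Q a c := by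
    simp only [dotProduct, mulVec, Fintype.sum_prod_type, Pi.star_apply, Q, Finset.mul_sum]
    exact Finset.sum_congr rfl fun a _ => Finset.sum_comm
  have hP : ∑ a, star (fun b => v (a, b)) ⬝ᵥ
      ((Matrix.of fun b b' => ∑ c, M (c, b) (c, b')) *ᵥ fun b => v (a, b)) =
      ∑ a, ∑ c, P a c := by
    refine Finset.sum_congr rfl fun a _ => ?_
    simp only [dotProduct, mulVec, Pi.star_apply, P, Finset.mul_sum, Matrix.of_apply,
      Finset.sum_mul]
    rw [Finset.sum_comm (s := (univ : Finset A))]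
    refine Finset.sum_congr rfl fun b _ => Finset.sum_comm
  rw [hQ, hP, ← sub_nonneg]
  rw [hsum] at hpos
  have h2 : (0 : ℂ) ≤ ((2⁻¹ : ℝ) : ℂ) := Complex.zero_le_real.2 (by norm_num)
  have h := mul_nonneg h2 hpos
  rwa [← mul_assoc, Complex.ofReal_inv, Complex.ofReal_ofNat, inv_mul_cancel₀ two_ne_zero,
    one_mul] at h

end QuadraticForm

/-! ### Doubly substochastic matrices from the reduction inequality -/

section Substochastic

/-- If `p i * t i j = s j * D i j` up to terms with `s j = 0`, where the rows of `t` sum to one and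
`D = p t / s` is doubly substochastic, then partial sums of `p` are bounded by weighted sums
of `s`. -/
theorem exists_weights_of_substochastic {ι κ : Type*} [Fintype ι] [Fintype κ]
    {p : ι → ℝ} {s : κ → ℝ} {t : ι → κ → ℝ} (hp : ∀ i, 0 ≤ p i) (hs : ∀ j, 0 ≤ s j)
    (ht : ∀ i j, 0 ≤ t i j) (hcol : ∀ j, ∑ i, p i * t i j = s j) (hrow : ∀ i, ∑ j, t i j = 1)
    (hsub : ∀ i, p i * ∑ j, (s j)⁻¹ * t i j ≤ 1) (S : Finset ι) :
    ∃ c : κ → ℝ, (∀ j, 0 ≤ c j) ∧ (∀ j, c j ≤ 1) ∧ ∑ j, c j ≤ S.card ∧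
      ∑ i ∈ S, p i ≤ ∑ j, s j * c j := by
  -- The weight at `j` is the part of column `j` of `D` lying in `S`; the convention `0⁻¹ = 0` makes
  -- it zero when `s j = 0`.
  refine ⟨fun j => ∑ i ∈ S, p i * ((s j)⁻¹ * t i j), fun j => ?_, fun j => ?_, ?_, ?_⟩
  · exact Finset.sum_nonneg fun i _ =>
      mul_nonneg (hp i) (mul_nonneg (inv_nonneg.2 (hs j)) (ht i j))
  · calc ∑ i ∈ S, p i * ((s j)⁻¹ * t i j) ≤ ∑ i, p i * ((s j)⁻¹ * t i j) :=
          Finset.sum_le_sum_of_subset_of_nonneg (Finset.subset_univ _) fun i _ _ =>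
            mul_nonneg (hp i) (mul_nonneg (inv_nonneg.2 (hs j)) (ht i j))
      _ = (s j)⁻¹ * s j := by
          rw [← hcol j, Finset.mul_sum]
          exact Finset.sum_congr rfl fun i _ => by ring
      _ ≤ 1 := inv_mul_le_one
  · rw [Finset.sum_comm]
    calc ∑ i ∈ S, ∑ j, p i * ((s j)⁻¹ * t i j) ≤ ∑ i ∈ S, (1 : ℝ) :=
          Finset.sum_le_sum fun i _ => by rw [← Finset.mul_sum]; exact hsub i
      _ = S.card := by simp
  · have hterm : ∀ i j, p i * t i j = s j * (p i * ((s j)⁻¹ * t i j)) := by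
      intro i j
      rcases eq_or_ne (s j) 0 with h | h
      -- A vanishing column sum of nonnegative terms forces `p i * t i j = 0`.
      · have := hcol j
        rw [h, Finset.sum_eq_zero_iff_of_nonneg
          fun i _ => mul_nonneg (hp i) (ht i j)] at this
        rw [this i (Finset.mem_univ _), h, zero_mul]
      · field_simp
    refine le_of_eq ?_
    simp only [Finset.mul_sum]
    rw [Finset.sum_comm]
    refine Finset.sum_congr rfl fun i _ => ?_
    simp only [← hterm]
    rw [← Finset.mul_sum, hrow, mul_one]

/-- If an ensemble of families of vectors satisfies the reduction inequality, then partial sums of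
its weights are bounded by weighted sums of the eigenvalues of its marginal. -/
theorem exists_weights_of_reduction {ι κ A H : Type*} [Fintype ι] [Fintype κ] [Fintype A]
    [NormedAddCommGroup H] [InnerProductSpace ℂ H] (f : OrthonormalBasis κ ℂ H)
    {p : ι → ℝ} {s : κ → ℝ} {x : ι → A → H} (hp : ∀ i, 0 ≤ p i) (hs : ∀ j, 0 ≤ s j)
    (hmarg : ∀ j, ∑ i, p i * ∑ a, ‖inner ℂ (f j) (x i a)‖ ^ 2 = s j)
    (hnorm : ∀ i, ∑ a, ‖x i a‖ ^ 2 = 1)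
    (hred : ∀ w : A → H, ∑ i, p i * ‖∑ a, inner ℂ (x i a) (w a)‖ ^ 2 ≤
      ∑ a, ∑ j, s j * ‖inner ℂ (f j) (w a)‖ ^ 2) (S : Finset ι) :
    ∃ c : κ → ℝ, (∀ j, 0 ≤ c j) ∧ (∀ j, c j ≤ 1) ∧ ∑ j, c j ≤ S.card ∧
      ∑ i ∈ S, p i ≤ ∑ j, s j * c j := by
  classical
  refine exists_weights_of_substochastic (t := fun i j => ∑ a, ‖inner ℂ (f j) (x i a)‖ ^ 2) hp hs
    (fun i j => Finset.sum_nonneg fun a _ => by positivity) hmarg (fun i => ?_) (fun i => ?_) S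
  · rw [Finset.sum_comm, ← hnorm i]
    exact Finset.sum_congr rfl fun a _ => f.sum_sq_norm_inner_right _
  · set τ : ℝ := ∑ j, (s j)⁻¹ * ∑ a, ‖inner ℂ (f j) (x i a)‖ ^ 2 with hτ
    have hτ0 : 0 ≤ τ := Finset.sum_nonneg fun j _ =>
      mul_nonneg (inv_nonneg.2 (hs j)) (Finset.sum_nonneg fun a _ => by positivity)
    -- `w = (1 ⊗ σ⁻¹) x i`, with the pseudo-inverse: both `⟨x i, w⟩` and `⟨w, (1 ⊗ σ) w⟩` equal `τ`.
    let w : A → H := fun a => ∑ j, (((s j)⁻¹ : ℝ) * inner ℂ (f j) (x i a) : ℂ) • f j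
    have hw : ∀ a j, inner ℂ (f j) (w a) = ((s j)⁻¹ : ℝ) * inner ℂ (f j) (x i a) := fun a j =>
      f.orthonormal.inner_right_fintype _ j
    have h1 : ∑ a, ∑ j, s j * ‖inner ℂ (f j) (w a)‖ ^ 2 = τ := by
      rw [hτ, Finset.sum_comm]
      refine Finset.sum_congr rfl fun j _ => ?_
      rw [Finset.mul_sum]
      refine Finset.sum_congr rfl fun a _ => ?_
      rw [hw, norm_mul, mul_pow, Complex.norm_real, Real.norm_of_nonneg (inv_nonneg.2 (hs j))]
      rcases eq_or_ne (s j) 0 with h | h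
      · simp [h]
      · field_simp
    have h2 : ∑ a, inner ℂ (x i a) (w a) = (τ : ℂ) := by
      rw [hτ]
      push_cast
      simp only [Finset.mul_sum]
      rw [Finset.sum_comm]
      refine Finset.sum_congr rfl fun a _ => ?_
      rw [inner_sum]
      refine Finset.sum_congr rfl fun j _ => ?_
      rw [inner_smul_right, ← inner_conj_symm (x i a) (f j), mul_assoc, Complex.mul_conj']
      push_cast
      rfl
    -- Only the `i`-th term of `ρ` is kept in the reduction inequality at `w`.
    have h3 : p i * τ ^ 2 ≤ τ := by
      have := Finset.single_le_sum (f := fun k => p k * ‖∑ a, inner ℂ (x k a) (w a)‖ ^ 2)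
        (fun k _ => mul_nonneg (hp k) (by positivity)) (Finset.mem_univ i)
      have h4 := this.trans (hred w)
      rw [h1] at h4
      simp only [h2, Complex.norm_real, Real.norm_of_nonneg hτ0] at h4
      exact h4
    rcases hτ0.eq_or_lt with h | h
    · rw [← h, mul_zero]; exact zero_le_one
    · refine le_of_mul_le_mul_right ?_ h
      rw [one_mul, mul_assoc, ← sq]
      exact h3

end Substochastic

/-! ### Sums of largest components -/

section SumLargest

variable {N : ℕ}

theorem sum_le_sumLargest (v : Fin N → ℝ) (s : Finset (Fin N)) : ∑ i ∈ s, v i ≤ sumLargest s.card v :=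
  le_ciSup (f := fun t : {t : Finset (Fin N) // t.card = s.card} => ∑ i ∈ t.1, v i)
    (Set.finite_range _).bddAbove ⟨s, rfl⟩

theorem sumLargest_le {k : ℕ} (hk : k ≤ N) {v : Fin N → ℝ} {C : ℝ}
    (h : ∀ s : Finset (Fin N), s.card = k → ∑ i ∈ s, v i ≤ C) : sumLargest k v ≤ C := by
  obtain ⟨s, -, hs⟩ := Finset.exists_subset_card_eq
    (s := (Finset.univ : Finset (Fin N))) (n := k) (by simpa using hk)
  -- Without a `k`-subset the supremum would be a default value; `k ≤ N` rules this out.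
  have : Nonempty {s : Finset (Fin N) // s.card = k} := ⟨⟨s, hs⟩⟩
  exact ciSup_le fun t => h t.1 t.2

/-- A weighted sum of a decreasing nonnegative vector, with weights in `[0, 1]` of total at most
`k`, is at most the sum of its `k` largest components. -/
theorem sum_mul_le_sumLargest {k : ℕ} (hk : k ≤ N) {v c : Fin N → ℝ} (hv : Antitone v)
    (hv0 : ∀ i, 0 ≤ v i) (hc0 : ∀ i, 0 ≤ c i) (hc1 : ∀ i, c i ≤ 1) (hc : ∑ i, c i ≤ k) :
    ∑ i, v i * c i ≤ sumLargest k v := by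
  set T : Finset (Fin N) := Finset.univ.filter fun i => (i : ℕ) < k with hT
  have hTcard : T.card = k := by
    rw [hT, Fin.card_filter_val_lt, min_eq_right hk]
  -- The threshold `θ` is the `(k+1)`-st largest component, or `0` if `k = N`.
  obtain ⟨θ, hθ0, hθ1, hθ2⟩ : ∃ θ : ℝ, 0 ≤ θ ∧ (∀ i ∈ T, θ ≤ v i) ∧ (∀ i ∉ T, v i ≤ θ) := by
    rcases Nat.lt_or_ge k N with h | h
    · refine ⟨v ⟨k, h⟩, hv0 _, fun i hi => hv ?_, fun i hi => hv ?_⟩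
      · exact Fin.le_def.2 (le_of_lt (by simpa [hT] using hi))
      · exact Fin.le_def.2 (by simpa [hT] using hi)
    · exact ⟨0, le_rfl, fun i _ => hv0 i, fun i hi => absurd (i.2.trans_le h) (by simpa [hT] using hi)⟩
  have hle := sum_le_sumLargest v T
  rw [hTcard] at hle
  refine le_trans ?_ hle
  have key : ∀ i, v i * c i ≤ (if i ∈ T then v i - θ else 0) + θ * c i := by
    intro i
    split_ifs with hi
    · nlinarith [hθ1 i hi, hc1 i]
    · rw [zero_add]; exact mul_le_mul_of_nonneg_right (hθ2 i hi) (hc0 i)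
  calc ∑ i, v i * c i ≤ ∑ i, ((if i ∈ T then v i - θ else 0) + θ * c i) :=
        Finset.sum_le_sum fun i _ => key i
    _ = ∑ i ∈ T, v i - k * θ + θ * ∑ i, c i := by
        rw [Finset.sum_add_distrib, ← Finset.mul_sum, Finset.sum_ite_mem, Finset.univ_inter,
          Finset.sum_sub_distrib, Finset.sum_const, hTcard, nsmul_eq_mul]
    _ ≤ ∑ i ∈ T, v i := by nlinarith

theorem Fin.sum_dite_lt {m : ℕ} (hm : m ≤ N) (g : Fin m → ℝ) :
    ∑ i : Fin N, (if h : (i : ℕ) < m then g ⟨i, h⟩ else 0) = ∑ j, g j := by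
  obtain ⟨d, rfl⟩ := Nat.exists_eq_add_of_le hm
  rw [Fin.sum_univ_add]
  simp

end SumLargest

/-! ### Ordered, zero-padded spectra -/

namespace DensityMatrix

variable {n : Type*} [Fintype n] [DecidableEq n] (ρ : DensityMatrix n)

/-- The bijection between positions in decreasing order and indices of eigenvalues. -/
noncomputable def eigenvalueEquiv (n : Type*) [Fintype n] : Fin (Fintype.card n) ≃ n :=
  Fintype.equivOfCardEq (Fintype.card_fin _)

theorem eigenvalues_eigenvalueEquiv (i : Fin (Fintype.card n)) :
    ρ.posSemidef.isHermitian.eigenvalues (eigenvalueEquiv n i) =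
      ρ.posSemidef.isHermitian.eigenvalues₀ i := by
  simp [Matrix.IsHermitian.eigenvalues, eigenvalueEquiv]

theorem eigenvalues₀_nonneg (i : Fin (Fintype.card n)) :
    0 ≤ ρ.posSemidef.isHermitian.eigenvalues₀ i := by
  rw [← eigenvalues_eigenvalueEquiv]
  exact ρ.posSemidef.eigenvalues_nonneg _

theorem spectrumVec_nonneg (N : ℕ) (i : Fin N) : 0 ≤ ρ.spectrumVec N i := by
  unfold spectrumVec
  split_ifs
  exacts [ρ.eigenvalues₀_nonneg _, le_rfl]

theorem spectrumVec_antitone (N : ℕ) : Antitone (ρ.spectrumVec N) := by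
  intro i j hij
  unfold spectrumVec
  split_ifs with h1 h2
  · exact ρ.posSemidef.isHermitian.eigenvalues₀_antitone hij
  · exact absurd ((Fin.le_def.1 hij).trans_lt h1) h2
  · exact ρ.eigenvalues₀_nonneg _
  · exact le_rfl

theorem sum_eigenvalues : ∑ i, ρ.posSemidef.isHermitian.eigenvalues i = 1 := by
  have h := ρ.posSemidef.isHermitian.trace_eq_sum_eigenvalues
  rw [ρ.trace_eq_one] at h
  have h' : ((∑ i, ρ.posSemidef.isHermitian.eigenvalues i : ℝ) : ℂ) = ((1 : ℝ) : ℂ) := by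
    push_cast; exact h.symm
  exact Complex.ofReal_injective h'

theorem sum_spectrumVec {N : ℕ} (hN : Fintype.card n ≤ N) : ∑ i, ρ.spectrumVec N i = 1 := by
  unfold spectrumVec
  rw [Fin.sum_dite_lt hN, ← ρ.sum_eigenvalues, ← (eigenvalueEquiv n).sum_comp]
  exact Finset.sum_congr rfl fun i _ => (ρ.eigenvalues_eigenvalueEquiv i).symm

theorem spectrumVec_mem_stdSimplex {N : ℕ} (hN : Fintype.card n ≤ N) :
    ρ.spectrumVec N ∈ stdSimplex ℝ (Fin N) :=
  ⟨ρ.spectrumVec_nonneg N, ρ.sum_spectrumVec hN⟩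

theorem sum_spectrumVec_card (s : Finset (Fin (Fintype.card n))) :
    ∑ i ∈ s, ρ.spectrumVec _ i =
      ∑ i ∈ s.map (eigenvalueEquiv n).toEmbedding, ρ.posSemidef.isHermitian.eigenvalues i := by
  rw [Finset.sum_map]
  refine Finset.sum_congr rfl fun i _ => ?_
  simp only [spectrumVec, i.2, dif_pos, Equiv.coe_toEmbedding, eigenvalues_eigenvalueEquiv]

theorem sum_eigenvalues_mul_le_sumLargest {k N : ℕ} (hk : k ≤ N) (hN : Fintype.card n ≤ N)
    {c : n → ℝ} (hc0 : ∀ j, 0 ≤ c j) (hc1 : ∀ j, c j ≤ 1) (hc : ∑ j, c j ≤ k) :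
    ∑ j, ρ.posSemidef.isHermitian.eigenvalues j * c j ≤ sumLargest k (ρ.spectrumVec N) := by
  let c' : Fin N → ℝ := fun i =>
    if h : (i : ℕ) < Fintype.card n then c (eigenvalueEquiv n ⟨i, h⟩) else 0
  have h1 : ∑ i, c' i = ∑ j, c j := by
    rw [← (eigenvalueEquiv n).sum_comp]
    exact Fin.sum_dite_lt hN fun i => c (eigenvalueEquiv n i)
  have h2 : ∑ i, ρ.spectrumVec N i * c' i =
      ∑ j, ρ.posSemidef.isHermitian.eigenvalues j * c j := by
    rw [← (eigenvalueEquiv n).sum_comp, ← Fin.sum_dite_lt hN]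
    refine Finset.sum_congr rfl fun i _ => ?_
    simp only [spectrumVec, c', eigenvalues_eigenvalueEquiv]
    split_ifs <;> simp
  rw [← h2]
  refine sum_mul_le_sumLargest hk (ρ.spectrumVec_antitone N) (ρ.spectrumVec_nonneg N)
    (fun i => ?_) (fun i => ?_) (h1.trans_le hc)
  · simp only [c']; split_ifs
    exacts [hc0 _, le_rfl]
  · simp only [c']; split_ifs
    exacts [hc1 _, zero_le_one]

/-! ### Majorization of a state by its marginal -/

variable {A B : Type*} [Fintype A] [Fintype B] [DecidableEq A] [DecidableEq B]

/-- For a state on `n ≃ A × B` with positive semidefinite partial transpose, the spectrum of its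
marginal on `B` majorizes its own spectrum. -/
theorem majorizes_of_partialTranspose_posSemidef (e : A × B ≃ n) (σ : DensityMatrix B)
    (hσ : σ.mat = Matrix.of fun b b' => ∑ a, ρ.mat (e (a, b)) (e (a, b')))
    (hT : (Matrix.of fun x y : A × B => ρ.mat (e (y.1, x.2)) (e (x.1, y.2))).PosSemidef)
    (hB : Fintype.card B ≤ Fintype.card n) :
    Majorizes (σ.spectrumVec (Fintype.card n)) (ρ.spectrumVec _) := by
  refine ⟨fun k hk => sumLargest_le hk fun S hS => ?_,
    (σ.sum_spectrumVec hB).trans (ρ.sum_spectrumVec le_rfl).symm⟩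
  set hρh := ρ.posSemidef.isHermitian
  set hσh := σ.posSemidef.isHermitian
  -- `x i a` is the slice at `a` of the `i`-th eigenvector of `ρ`.
  let x : n → A → EuclideanSpace ℂ B := fun i a =>
    WithLp.toLp 2 fun b => hρh.eigenvectorBasis i (e (a, b))
  let M : Matrix (A × B) (A × B) ℂ := ρ.mat.submatrix e e
  -- The quadratic form of `ρ`, transported to `A × B`.
  have hform : ∀ w : A → EuclideanSpace ℂ B,
      star (fun y : A × B => w y.1 y.2) ⬝ᵥ (M *ᵥ fun y : A × B => w y.1 y.2) =
        ((∑ i, hρh.eigenvalues i * ‖∑ a, inner ℂ (x i a) (w a)‖ ^ 2 : ℝ) : ℂ) := by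
    intro w
    let v : EuclideanSpace ℂ n := WithLp.toLp 2 fun z => w (e.symm z).1 (e.symm z).2
    have hv : ∀ y, v (e y) = w y.1 y.2 := fun y => by simp [v]
    have h1 : star (fun y : A × B => w y.1 y.2) ⬝ᵥ (M *ᵥ fun y : A × B => w y.1 y.2) =
        star v.ofLp ⬝ᵥ (ρ.mat *ᵥ v.ofLp) := by
      simp only [dotProduct, mulVec, ← e.sum_comp, Pi.star_apply, hv, M, Matrix.submatrix_apply]
    rw [h1, hρh.dotProduct_mulVec_eq_sum v]
    congr 1
    refine Finset.sum_congr rfl fun i _ => ?_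
    congr 3
    simp only [PiLp.inner_apply, ← e.sum_comp, Fintype.sum_prod_type, hv, x]
  have hσM : σ.mat = Matrix.of fun b b' => ∑ a, M (a, b) (a, b') := hσ
  have hmarg : ∀ u : EuclideanSpace ℂ B, star u.ofLp ⬝ᵥ (σ.mat *ᵥ u.ofLp) =
      ((∑ i, hρh.eigenvalues i * ∑ a, ‖inner ℂ (x i a) u‖ ^ 2 : ℝ) : ℂ) := by
    intro u
    -- The marginal's form at `u` is the sum of the forms of `M` at `e_a ⊗ u`.
    have h1 : star u.ofLp ⬝ᵥ (σ.mat *ᵥ u.ofLp) = ∑ a, star (fun y : A × B =>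
        (Pi.single a u : A → EuclideanSpace ℂ B) y.1 y.2) ⬝ᵥ (M *ᵥ fun y : A × B =>
        (Pi.single a u : A → EuclideanSpace ℂ B) y.1 y.2) := by
      have h2 : ∀ a : A, star (fun y : A × B =>
          (Pi.single a u : A → EuclideanSpace ℂ B) y.1 y.2) ⬝ᵥ (M *ᵥ fun y : A × B =>
          (Pi.single a u : A → EuclideanSpace ℂ B) y.1 y.2) =
          ∑ b, ∑ b', star (u b) * (M (a, b) (a, b') * u b') := by
        intro a
        simp only [dotProduct, mulVec, Fintype.sum_prod_type, Pi.star_apply]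
        rw [Finset.sum_eq_single a (fun c _ hc => by simp [Pi.single_eq_of_ne hc]) (by simp)]
        refine Finset.sum_congr rfl fun b _ => ?_
        rw [Finset.sum_eq_single a (fun c _ hc => by simp [Pi.single_eq_of_ne hc]) (by simp),
          Pi.single_eq_same, Finset.mul_sum]
      rw [Finset.sum_congr rfl fun a _ => h2 a]
      simp only [hσM, dotProduct, mulVec, Matrix.of_apply, Finset.sum_mul, Finset.mul_sum,
        Pi.star_apply]
      rw [Finset.sum_comm (s := (univ : Finset A))]
      exact Finset.sum_congr rfl fun b _ => Finset.sum_comm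
    rw [h1]
    simp only [hform]
    rw [← Complex.ofReal_sum]
    congr 1
    rw [Finset.sum_comm]
    refine Finset.sum_congr rfl fun i _ => ?_
    rw [Finset.mul_sum]
    refine Finset.sum_congr rfl fun a _ => ?_
    rw [Finset.sum_eq_single a (fun c _ hc => by simp [Pi.single_eq_of_ne hc]) (by simp),
      Pi.single_eq_same]
  have hmargEig : ∀ j, ∑ i, hρh.eigenvalues i *
      ∑ a, ‖inner ℂ (hσh.eigenvectorBasis j) (x i a)‖ ^ 2 = hσh.eigenvalues j := by
    intro j
    have h := (hmarg (hσh.eigenvectorBasis j)).symm.trans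
      (hσh.dotProduct_mulVec_eq_sum (hσh.eigenvectorBasis j))
    have h' := Complex.ofReal_injective h
    rw [Finset.sum_eq_single j (fun l _ hl => by
      rw [hσh.eigenvectorBasis.inner_eq_zero hl]; simp) (by simp)] at h'
    rw [hσh.eigenvectorBasis.inner_eq_one, norm_one, one_pow, mul_one] at h'
    rw [← h']
    simp only [norm_inner_symm]
  have hnorm : ∀ i, ∑ a, ‖x i a‖ ^ 2 = 1 := by
    intro i
    have h1 : ‖hρh.eigenvectorBasis i‖ ^ 2 = 1 := by simp
    rw [← h1, EuclideanSpace.norm_sq_eq, ← e.sum_comp, Fintype.sum_prod_type]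
    simp only [EuclideanSpace.norm_sq_eq, x]
  have hred : ∀ w : A → EuclideanSpace ℂ B,
      ∑ i, hρh.eigenvalues i * ‖∑ a, inner ℂ (x i a) (w a)‖ ^ 2 ≤
        ∑ a, ∑ j, hσh.eigenvalues j * ‖inner ℂ (hσh.eigenvectorBasis j) (w a)‖ ^ 2 := by
    intro w
    have h := dotProduct_mulVec_le_of_partialTranspose_posSemidef (M := M) hT
      (fun y : A × B => w y.1 y.2)
    rw [hform, ← hσM] at h
    have h2 : ∀ a, star (fun b => w a b) ⬝ᵥ (σ.mat *ᵥ fun b => w a b) = _ := fun a =>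
      hσh.dotProduct_mulVec_eq_sum (w a)
    simp only [h2] at h
    rw [← Complex.ofReal_sum] at h
    exact Complex.real_le_real.1 h
  obtain ⟨c, hc0, hc1, hc, hle⟩ := exists_weights_of_reduction hσh.eigenvectorBasis
    ρ.posSemidef.eigenvalues_nonneg σ.posSemidef.eigenvalues_nonneg hmargEig hnorm hred
    (S.map (eigenvalueEquiv n).toEmbedding)
  rw [Finset.card_map, hS] at hc
  rw [sum_spectrumVec_card]
  exact hle.trans (σ.sum_eigenvalues_mul_le_sumLargest hk hB hc0 hc1 hc)

end DensityMatrix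

/-! ### The two criteria for states that are not NPT -/

namespace DensityMatrix

variable {A B : Type*} [Fintype A] [Fintype B] [DecidableEq A] [DecidableEq B]
  (ρ : DensityMatrix (A × B))

theorem partialTranspose_posSemidef_of_not_isNPT (h : ¬ ρ.IsNPT) :
    ρ.partialTranspose.PosSemidef := by
  rw [ρ.partialTranspose_isHermitian.posSemidef_iff_eigenvalues_nonneg]
  intro i
  simp only [IsNPT, not_exists, not_lt] at h
  exact h i

/-- An empty trace is zero, not one. Nonempty factors ensure that padding a marginal's spectrum to
the product dimension cuts nothing off. -/
theorem nonempty_index {n : Type*} [Fintype n] (ρ : DensityMatrix n) : Nonempty n := by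
  by_contra h
  rw [not_nonempty_iff] at h
  have := ρ.trace_eq_one
  simp [Matrix.trace] at this

theorem card_left_le {A B : Type*} [Fintype A] [Fintype B] (ρ : DensityMatrix (A × B)) :
    Fintype.card A ≤ Fintype.card (A × B) := by
  obtain ⟨-, b⟩ := ρ.nonempty_index
  exact Fintype.card_le_of_injective (fun a => (a, b)) fun a a' h => (Prod.ext_iff.1 h).1

theorem card_right_le {A B : Type*} [Fintype A] [Fintype B] (ρ : DensityMatrix (A × B)) :
    Fintype.card B ≤ Fintype.card (A × B) := by
  obtain ⟨a, -⟩ := ρ.nonempty_index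
  exact Fintype.card_le_of_injective (fun b => (a, b)) fun b b' h => (Prod.ext_iff.1 h).2

/-- A state with positive semidefinite partial transpose satisfies the majorization criterion. -/
theorem majorizationCriterion_of_not_isNPT (h : ¬ ρ.IsNPT) : ρ.MajorizationCriterion := by
  have hT := ρ.partialTranspose_posSemidef_of_not_isNPT h
  -- Swapping the factors turns the transpose on `B` into one on the first factor; for the other
  -- marginal, a full transpose does so.
  exact ⟨ρ.majorizes_of_partialTranspose_posSemidef (Equiv.prodComm B A) ρ.marginalA rfl
      (hT.submatrix Prod.swap) ρ.card_left_le,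
    ρ.majorizes_of_partialTranspose_posSemidef (Equiv.refl _) ρ.marginalB rfl
      hT.transpose ρ.card_right_le⟩

theorem mixednessCriterion_of_majorizationCriterion (h : ρ.MajorizationCriterion)
    {F : (Fin (Fintype.card (A × B)) → ℝ) → ℝ} (hF : IsMixednessMeasure F) :
    ρ.MixednessCriterion F :=
  max_le
    (hF.schurConcave _ (ρ.marginalA.spectrumVec_mem_stdSimplex ρ.card_left_le) _
      (ρ.spectrumVec_mem_stdSimplex le_rfl) h.1)
    (hF.schurConcave _ (ρ.marginalB.spectrumVec_mem_stdSimplex ρ.card_right_le) _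
      (ρ.spectrumVec_mem_stdSimplex le_rfl) h.2)

end DensityMatrix

theorem theorem1 {A B : Type*} [Fintype A] [Fintype B] [DecidableEq A] [DecidableEq B]
    (ρ : DensityMatrix (A × B)) :
    ((∃ F : (Fin (Fintype.card (A × B)) → ℝ) → ℝ,
        IsMixednessMeasure F ∧ ¬ ρ.MixednessCriterion F) → ρ.IsNPT) ∧
      (¬ ρ.MajorizationCriterion → ρ.IsNPT) := by
  refine ⟨?_, fun h => ?_⟩
  · rintro ⟨F, hF, hFρ⟩
    by_contra h
    exact hFρ (ρ.mixednessCriterion_of_majorizationCriterion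
      (ρ.majorizationCriterion_of_not_isNPT h) hF)
  · by_contra h'
    exact h (ρ.majorizationCriterion_of_not_isNPT h')
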